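/- Let $K\subset\mathbb R^n$ be a symmetric convex body, that is, a compact convex set with non-empty interior such that $-K=K$, and let $|\cdot|$ denote $n$-dimensional Lebesgue measure. Let $0<\delta<|K|$. Then the convolution body $$K(\delta)=\{x\in\mathbb R^n : |K\cap(x+K)|\ge\delta\}$$ is strictly convex, that is, for all distinct points $x,y\in K(\delta)$ and all $0<t<1$, the point $(1-t)x+ty$ lies in the interior of $K(\delta)$. -/

import Mathlib

open scoped Pointwise

/-- The convolution body `K(δ) = {x ∈ ℝⁿ : |K ∩ (x + K)| ≥ δ}`, where `|·|` is the
`n`-dimensional Lebesgue measure. -/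
def convolutionBody {n : ℕ} (K : Set (EuclideanSpace ℝ (Fin n))) (δ : ℝ) :
    Set (EuclideanSpace ℝ (Fin n)) :=
  {x | δ ≤ MeasureTheory.volume.real (K ∩ (x +ᵥ K))}

/-! Translating by `-x/2` turns `K ∩ (x + K)` into the symmetric convex set `C_s = (K - s) ∩ (K +
s)` with `s = x/2`, and convexity of `K` gives `a C_p + b C_q ⊆ C_m` for `m = a p + b q`.
Brunn–Minkowski then yields `|C_m| ≥ |C_p|^a |C_q|^b ≥ δ`. If `|C_m| = δ`, all three volumes are
`δ`; the equality case, in which symmetry excludes translations, forces `C_p = C_q = C_m`, and this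
is impossible for `p ≠ q` (`eq_of_centeredIntersection_eq`). So `|C_m| > δ`, an open condition on
the point because the volume of the intersection is continuous.

The equality case (`eq_of_volume_real_eq`) comes from perturbing Prékopa–Leindler around sets of
equal volume. Exponentials of small linear functionals show that second moments are concave along
`A`, `B`, `C`. Perturbing by `-‖x‖²` gives the opposite bound, with room for a small multiple of a
1-Lipschitz function `g`; together they give `∫_A g ≤ ∫_B g`. The choice of `g` as distance to `B`
puts `A` inside `B`. -/

open MeasureTheory Set Filter Topology
open scoped ENNReal Pointwise

/-! ### Brunn–Minkowski and Prékopa–Leindler on the line -/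

/-- The one-dimensional Brunn–Minkowski inequality for compact sets. -/
theorem Real.volume_add_le_of_isCompact {S T U : Set ℝ} (hS : IsCompact S) (hT : IsCompact T)
    (hS0 : S.Nonempty) (hT0 : T.Nonempty) (hU : ∀ x ∈ S, ∀ y ∈ T, x + y ∈ U) :
    volume S + volume T ≤ volume U := by
  obtain ⟨M, hM, hMS⟩ := hS.exists_isGreatest hS0
  obtain ⟨m, hm, hmT⟩ := hT.exists_isLeast hT0
  -- `S + m` lies to the left of `M + m` and `M + T` to the right; they share only the point `M +
  -- m`, which is discarded from the right half.
  rw [← measure_inter_add_sdiff U (measurableSet_Iic (a := M + m))]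
  refine add_le_add ?_ ?_
  · rw [← measure_preimage_add_right volume (-m) S]
    refine measure_mono fun x hx => ⟨?_, ?_⟩
    · simpa using hU _ hx m hm
    · have := hMS hx
      simp only [mem_Iic]; linarith
  · rw [← measure_preimage_add_right volume (-M) T,
      ← measure_sdiff_null (measure_singleton (M + m))]
    refine measure_mono fun x hx => ⟨?_, ?_⟩
    · simpa using hU M hM _ hx.1
    · have h1 := hmT hx.1
      have h2 : x ≠ M + m := hx.2
      simp only [mem_Iic, not_le]
      exact lt_of_le_of_ne (by linarith) h2.symm

/-- The one-dimensional Brunn–Minkowski inequality for convex combinations of measurable sets. -/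
theorem Real.ofReal_mul_volume_add_le {S T U : Set ℝ} {a b : ℝ} (ha : 0 < a) (hb : 0 < b)
    (hS : MeasurableSet S) (hT : MeasurableSet T) (hS0 : S.Nonempty) (hT0 : T.Nonempty)
    (hU : ∀ x ∈ S, ∀ y ∈ T, a * x + b * y ∈ U) :
    ENNReal.ofReal a * volume S + ENNReal.ofReal b * volume T ≤ volume U := by
  have key : ∀ S' ⊆ S, IsCompact S' → ∀ T' ⊆ T, IsCompact T' →
      ENNReal.ofReal a * volume S' + ENNReal.ofReal b * volume T' ≤ volume U := by
    obtain ⟨s, hs⟩ := hS0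
    obtain ⟨t, ht⟩ := hT0
    intro S' hS' hSc T' hT' hTc
    -- Inserting `s` and `t` keeps the compact sets nonempty, since `S'` or `T'` may be empty.
    have := Real.volume_add_le_of_isCompact (S := (a * ·) '' (insert s S'))
      (T := (b * ·) '' (insert t T')) (U := U)
      ((hSc.insert s).image (by fun_prop)) ((hTc.insert t).image (by fun_prop))
      ((insert_nonempty _ _).image _) ((insert_nonempty _ _).image _) (by
        rintro _ ⟨x, hx, rfl⟩ _ ⟨y, hy, rfl⟩
        exact hU x (insert_subset hs hS' hx) y (insert_subset ht hT' hy))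
    have hsc : ∀ (c : ℝ) (X : Set ℝ), 0 < c →
        volume ((c * ·) '' X) = ENNReal.ofReal c * volume X := by
      intro c X hc
      have := Measure.addHaar_smul (volume : Measure ℝ) c X
      rw [← image_smul] at this
      simpa only [smul_eq_mul, Module.finrank_self, pow_one, abs_of_pos hc] using this
    rw [hsc _ _ ha, hsc _ _ hb] at this
    refine le_trans ?_ this
    gcongr <;> exact subset_insert _ _
  rw [hS.measure_eq_iSup_isCompact, hT.measure_eq_iSup_isCompact]
  simp only [ENNReal.mul_iSup, iSup_and']
  exact ENNReal.biSup_add_biSup_le' ⟨∅, empty_subset _, isCompact_empty⟩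
    ⟨∅, empty_subset _, isCompact_empty⟩ fun S' h T' h' => key S' h.1 h.2 T' h'.1 h'.2

/-- The Prékopa–Leindler inequality on `ℝ`, in its arithmetic form, for functions normalized to have
supremum one. -/
theorem Real.ofReal_mul_lintegral_add_le {f g h : ℝ → ℝ≥0∞} {a b : ℝ} (ha : 0 < a) (hb : 0 < b)
    (hab : a + b = 1) (hf : Measurable f) (hg : Measurable g) (hh : Measurable h)
    (hfgh : ∀ x y, f x ^ a * g y ^ b ≤ h (a * x + b * y)) (hf1 : ⨆ x, f x = 1)
    (hg1 : ⨆ x, g x = 1) :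
    ENNReal.ofReal a * (∫⁻ x, f x) + ENNReal.ofReal b * (∫⁻ x, g x) ≤ ∫⁻ x, h x := by
  have layer : ∀ u : ℝ → ℝ≥0∞, Measurable u → (∀ x, u x ≤ 1) →
      ∫⁻ x, u x = ∫⁻ t in Ioi (0 : ℝ), volume {x | ENNReal.ofReal t < u x} := by
    intro u hu hu1
    have hfin : ∀ x, u x ≠ ⊤ := fun x => ne_top_of_le_ne_top ENNReal.one_ne_top (hu1 x)
    have := lintegral_eq_lintegral_meas_lt volume (f := fun x => (u x).toReal)
      (Eventually.of_forall fun x => ENNReal.toReal_nonneg) hu.ennreal_toReal.aemeasurable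
    simp only [ENNReal.ofReal_toReal (hfin _)] at this
    rw [this]
    refine setLIntegral_congr_fun measurableSet_Ioi fun t ht => ?_
    simp only [ENNReal.ofReal_lt_iff_lt_toReal (le_of_lt ht) (hfin _)]
  have hf1' : ∀ x, f x ≤ 1 := fun x => hf1 ▸ le_iSup f x
  have hg1' : ∀ x, g x ≤ 1 := fun x => hg1 ▸ le_iSup g x
  -- Only levels `t < 1` matter on the left, so `h` may be capped at 1 before integrating over
  -- superlevel sets.
  calc _ ≤ ∫⁻ x, min (h x) 1 := ?_
    _ ≤ _ := lintegral_mono fun x => min_le_left _ _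
  rw [layer f hf hf1', layer g hg hg1',
    layer (fun x => min (h x) 1) (hh.min measurable_const) fun x => min_le_right _ _,
    ← lintegral_const_mul' _ _ ENNReal.ofReal_ne_top,
    ← lintegral_const_mul' _ _ ENNReal.ofReal_ne_top]
  refine (le_lintegral_add _ _).trans (setLIntegral_mono' measurableSet_Ioi fun t ht => ?_)
  have ht : 0 < t := ht
  rcases lt_or_ge t 1 with h1 | h1
  · have h1' : ENNReal.ofReal t < 1 := by simpa using h1
    -- Both suprema being exactly 1 makes the two superlevel sets nonempty at every level below 1.
    refine Real.ofReal_mul_volume_add_le ha hb (measurableSet_lt measurable_const hf)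
      (measurableSet_lt measurable_const hg) (lt_iSup_iff.1 (hf1.symm ▸ h1' : _ < ⨆ x, f x))
      (lt_iSup_iff.1 (hg1.symm ▸ h1' : _ < ⨆ x, g x))
      fun x hx y hy => lt_min (lt_of_lt_of_le ?_ (hfgh x y)) h1'
    have h0 : ENNReal.ofReal t ≠ 0 := by simpa using ht
    calc ENNReal.ofReal t = ENNReal.ofReal t ^ a * ENNReal.ofReal t ^ b := by
          rw [← ENNReal.rpow_add _ _ h0 ENNReal.ofReal_ne_top, hab, ENNReal.rpow_one]
      _ < _ := ENNReal.mul_lt_mul (ENNReal.rpow_lt_rpow hx ha) (ENNReal.rpow_lt_rpow hy hb)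
  · have h1' : 1 ≤ ENNReal.ofReal t := by simpa using h1
    have e1 : {x | ENNReal.ofReal t < f x} = ∅ := by
      ext x; simpa using (hf1' x).trans h1'
    have e2 : {x | ENNReal.ofReal t < g x} = ∅ := by
      ext x; simpa using (hg1' x).trans h1'
    simp [e1, e2]

theorem ENNReal.geom_mean_le_arith_mean2_weighted {a b : ℝ} (ha : 0 < a) (hb : 0 < b)
    (hab : a + b = 1) (p q : ℝ≥0∞) :
    p ^ a * q ^ b ≤ ENNReal.ofReal a * p + ENNReal.ofReal b * q := by
  have ha' : ENNReal.ofReal a ≠ 0 := by simpa using ha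
  have hb' : ENNReal.ofReal b ≠ 0 := by simpa using hb
  induction p with
  | top => simp [ENNReal.mul_top ha']
  | coe p =>
    induction q with
    | top => simp [ENNReal.mul_top hb']
    | coe q =>
      have := NNReal.geom_mean_le_arith_mean2_weighted ⟨a, ha.le⟩ ⟨b, hb.le⟩ p q
        (NNReal.eq hab)
      have h2 := ENNReal.coe_le_coe.2 this
      rw [← ENNReal.coe_rpow_of_nonneg _ ha.le, ← ENNReal.coe_rpow_of_nonneg _ hb.le,
        ENNReal.ofReal_eq_coe_nnreal ha.le, ENNReal.ofReal_eq_coe_nnreal hb.le]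
      exact_mod_cast h2

/-- Dividing `f`, `g`, `h` by `F`, `G`, `F^a G^b`, with `F`, `G` the suprema, reduces to the
normalized arithmetic form, and weighted AM–GM returns to the geometric form. The bound `N` keeps
the suprema finite. -/
theorem Real.prekopa_leindler_of_bounded {f g h : ℝ → ℝ≥0∞} {a b : ℝ} (ha : 0 < a) (hb : 0 < b)
    (hab : a + b = 1) (hf : Measurable f) (hg : Measurable g) (hh : Measurable h)
    (hfgh : ∀ x y, f x ^ a * g y ^ b ≤ h (a * x + b * y)) {N : ℝ≥0∞} (hN : N ≠ ⊤)
    (hfN : ∀ x, f x ≤ N) (hgN : ∀ x, g x ≤ N) :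
    (∫⁻ x, f x) ^ a * (∫⁻ x, g x) ^ b ≤ ∫⁻ x, h x := by
  set F := ⨆ x, f x with hF
  set G := ⨆ x, g x with hG
  have hFt : F ≠ ⊤ := ne_top_of_le_ne_top hN (iSup_le hfN)
  have hGt : G ≠ ⊤ := ne_top_of_le_ne_top hN (iSup_le hgN)
  rcases eq_or_ne F 0 with hF0 | hF0
  · have : ∀ x, f x = 0 := by simpa [F] using hF0
    simp [this, ENNReal.zero_rpow_of_pos ha]
  rcases eq_or_ne G 0 with hG0 | hG0
  · have : ∀ x, g x = 0 := by simpa [G] using hG0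
    simp [this, ENNReal.zero_rpow_of_pos hb]
  set c := (F⁻¹) ^ a * (G⁻¹) ^ b with hc
  have hc0 : c ≠ 0 := by simp [c, hFt, hGt, ha, hb, ENNReal.rpow_eq_zero_iff, ha.not_gt, hb.not_gt]
  have hct : c ≠ ⊤ := by
    refine ENNReal.mul_ne_top ?_ ?_ <;>
      exact ENNReal.rpow_ne_top_of_nonneg (by positivity) (by simpa)
  have h1 := Real.ofReal_mul_lintegral_add_le (f := fun x => F⁻¹ * f x) (g := fun x => G⁻¹ * g x)
    (h := fun x => c * h x) ha hb hab (hf.const_mul _) (hg.const_mul _) (hh.const_mul _)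
    (fun x y => by
      rw [ENNReal.mul_rpow_of_nonneg _ _ ha.le, ENNReal.mul_rpow_of_nonneg _ _ hb.le,
        mul_mul_mul_comm]
      gcongr
      exact hfgh x y)
    (by rw [← ENNReal.mul_iSup]; exact ENNReal.inv_mul_cancel hF0 hFt)
    (by rw [← ENNReal.mul_iSup]; exact ENNReal.inv_mul_cancel hG0 hGt)
  have h2 := (ENNReal.geom_mean_le_arith_mean2_weighted ha hb hab _ _).trans h1
  rw [lintegral_const_mul _ hf, lintegral_const_mul _ hg, lintegral_const_mul _ hh,
    ENNReal.mul_rpow_of_nonneg _ _ ha.le, ENNReal.mul_rpow_of_nonneg _ _ hb.le,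
    mul_mul_mul_comm] at h2
  exact (ENNReal.mul_le_mul_iff_right hc0 hct).1 h2

/-- The Prékopa–Leindler inequality on `ℝ`. -/
theorem Real.prekopa_leindler {f g h : ℝ → ℝ≥0∞} {a b : ℝ} (ha : 0 < a) (hb : 0 < b)
    (hab : a + b = 1) (hf : Measurable f) (hg : Measurable g) (hh : Measurable h)
    (hfgh : ∀ x y, f x ^ a * g y ^ b ≤ h (a * x + b * y)) :
    (∫⁻ x, f x) ^ a * (∫⁻ x, g x) ^ b ≤ ∫⁻ x, h x := by
  have htr : ∀ u : ℝ → ℝ≥0∞, Measurable u →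
      Tendsto (fun N : ℕ => ∫⁻ x, min (u x) N) atTop (𝓝 (∫⁻ x, u x)) := by
    intro u hu
    refine lintegral_tendsto_of_tendsto_of_monotone (fun N => (hu.min measurable_const).aemeasurable)
      (ae_of_all _ fun x N M hNM => ?_) (ae_of_all _ fun x => ?_)
    · exact min_le_min_left _ (by exact_mod_cast hNM)
    · simpa using (tendsto_const_nhds (x := u x)).min ENNReal.tendsto_nat_nhds_top
  rcases eq_or_ne (∫⁻ x, f x) 0 with hf0 | hf0
  · simp [hf0, ENNReal.zero_rpow_of_pos ha]
  rcases eq_or_ne (∫⁻ x, g x) 0 with hg0 | hg0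
  · simp [hg0, ENNReal.zero_rpow_of_pos hb]
  -- Truncations at `N` increase to `f` and `g`; the zero cases were removed because multiplication
  -- on `ℝ≥0∞` is discontinuous at `(0, ⊤)`.
  refine le_of_tendsto (ENNReal.Tendsto.mul
    ((ENNReal.continuous_rpow_const.tendsto _).comp (htr f hf)) (Or.inl ?_)
    ((ENNReal.continuous_rpow_const.tendsto _).comp (htr g hg)) (Or.inl ?_))
    (Eventually.of_forall fun N => ?_)
  · simp [ENNReal.rpow_eq_zero_iff, hf0, ha.not_gt]
  · simp [ENNReal.rpow_eq_zero_iff, hg0, hb.not_gt]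
  · refine Real.prekopa_leindler_of_bounded ha hb hab (hf.min measurable_const)
      (hg.min measurable_const) hh (fun x y => le_trans ?_ (hfgh x y)) (ENNReal.natCast_ne_top N)
      (fun x => min_le_right _ _) (fun x => min_le_right _ _)
    gcongr <;> exact min_le_left _ _

/-! ### Prékopa–Leindler in dimension n -/

/-- The Prékopa–Leindler inequality on `Fin n → ℝ`. -/
theorem prekopa_leindler_pi {n : ℕ} {f g h : (Fin n → ℝ) → ℝ≥0∞} {a b : ℝ} (ha : 0 < a)
    (hb : 0 < b) (hab : a + b = 1) (hf : Measurable f) (hg : Measurable g) (hh : Measurable h)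
    (hfgh : ∀ x y, f x ^ a * g y ^ b ≤ h (a • x + b • y)) :
    (∫⁻ x, f x) ^ a * (∫⁻ x, g x) ^ b ≤ ∫⁻ x, h x := by
  induction n with
  | zero =>
    have : (volume : Measure (Fin 0 → ℝ)) = Measure.dirac 0 := by
      rw [volume_pi, Measure.pi_of_empty]
      congr!
    simp only [this, lintegral_dirac]
    simpa using hfgh 0 0
  | succ n ih =>
    have he := (volume_preserving_piFinSuccAbove (fun _ : Fin (n + 1) => ℝ) 0).symm
    have hslice : ∀ u : (Fin (n + 1) → ℝ) → ℝ≥0∞, Measurable u →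
        ∫⁻ x, u x = ∫⁻ s : ℝ, ∫⁻ z : Fin n → ℝ, u (Fin.cons s z) := by
      intro u hu
      rw [← he.lintegral_comp hu, Measure.volume_eq_prod,
        lintegral_prod (fun p => u ((MeasurableEquiv.piFinSuccAbove (fun _ => ℝ) 0).symm p))
          (hu.comp he.measurable).aemeasurable]
      simp [MeasurableEquiv.piFinSuccAbove, Fin.insertNthEquiv]
    have hcons : Measurable fun p : ℝ × (Fin n → ℝ) => (Fin.cons p.1 p.2 : Fin (n + 1) → ℝ) := by
      refine measurable_pi_lambda _ fun i => ?_
      refine Fin.cases ?_ (fun j => ?_) i <;> simp only [Fin.cons_zero, Fin.cons_succ] <;> fun_prop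
    rw [hslice f hf, hslice g hg, hslice h hh]
    -- The one-dimensional inequality is applied to the integrals over slices; its hypothesis is the
    -- induction hypothesis on the slices.
    refine Real.prekopa_leindler ha hb hab (hf.comp hcons).lintegral_prod_right'
      (hg.comp hcons).lintegral_prod_right' (hh.comp hcons).lintegral_prod_right' fun s r => ?_
    refine ih (hf.comp (hcons.comp measurable_prodMk_left))
      (hg.comp (hcons.comp measurable_prodMk_left))
      (hh.comp (hcons.comp measurable_prodMk_left)) fun z w => ?_
    refine (hfgh _ _).trans (le_of_eq (congrArg h ?_))
    ext i
    refine Fin.cases ?_ (fun j => ?_) i <;> simp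

/-- The Prékopa–Leindler inequality on Euclidean space. -/
theorem prekopa_leindler {n : ℕ} {f g h : EuclideanSpace ℝ (Fin n) → ℝ≥0∞} {a b : ℝ} (ha : 0 < a)
    (hb : 0 < b) (hab : a + b = 1) (hf : Measurable f) (hg : Measurable g) (hh : Measurable h)
    (hfgh : ∀ x y, f x ^ a * g y ^ b ≤ h (a • x + b • y)) :
    (∫⁻ x, f x) ^ a * (∫⁻ x, g x) ^ b ≤ ∫⁻ x, h x := by
  have he := PiLp.volume_preserving_toLp (Fin n)
  rw [← he.lintegral_comp hf, ← he.lintegral_comp hg, ← he.lintegral_comp hh]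
  exact prekopa_leindler_pi ha hb hab (hf.comp he.measurable) (hg.comp he.measurable)
    (hh.comp he.measurable) fun x y => hfgh _ _

/-! ### Perturbation of Prékopa–Leindler around sets of equal volume -/

theorem Real.one_add_sq_div_two_le_cosh (x : ℝ) : 1 + x ^ 2 / 2 ≤ Real.cosh x := by
  have h1 : Real.cosh x = 1 + 2 * Real.sinh (x / 2) ^ 2 := by
    have := Real.cosh_two_mul (x / 2)
    rw [Real.cosh_sq, mul_div_cancel₀ _ (two_ne_zero)] at this
    linarith
  have h2 : (x / 2) ^ 2 ≤ Real.sinh (x / 2) ^ 2 := by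
    rw [sq_le_sq, Real.abs_sinh]
    exact Real.self_le_sinh_iff.2 (abs_nonneg _)
  rw [h1]; linarith

/-- First-order consequence of a geometric-mean inequality that is an equality at `η = 0`. -/
theorem Real.add_le_of_rpow_mul_rpow_le {a b V p q x K : ℝ} (hab : a + b = 1) (hV : 0 < V)
    (h : ∀ᶠ η in 𝓝[>] (0 : ℝ), (V + η * p) ^ a * (V + η * q) ^ b ≤ V + η * x + η ^ 2 * K) :
    a * p + b * q ≤ x := by
  have hlin : ∀ c : ℝ, HasDerivAt (fun η : ℝ => V + η * c) c 0 := fun c => by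
    simpa using ((hasDerivAt_id (0 : ℝ)).mul_const c).const_add V
  have hpow : ∀ c e : ℝ, HasDerivAt (fun η : ℝ => (V + η * c) ^ e) (c * e * V ^ (e - 1)) 0 :=
    fun c e => by simpa using (hlin c).rpow_const (p := e) (Or.inl (by simpa using hV.ne'))
  have hsq : HasDerivAt (fun η : ℝ => η ^ 2 * K) 0 0 := by
    simpa using ((hasDerivAt_id (0 : ℝ)).pow 2).mul_const K
  -- Both sides equal `V` at `η = 0`, so their difference has nonnegative right derivative there.
  have hd := (((hlin x).add hsq).sub ((hpow p a).mul (hpow q b))).tendsto_slope_zero_right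
  have h0 := ge_of_tendsto hd (b := 0) (by
    filter_upwards [h, self_mem_nhdsWithin] with η hη hpos
    have hpos : 0 < η := hpos
    have hVV : V ^ a * V ^ b = V := by rw [← Real.rpow_add hV, hab, Real.rpow_one]
    simp only [smul_eq_mul, zero_add, Pi.add_apply, Pi.sub_apply, Pi.mul_apply, zero_mul, add_zero,
      hVV, ne_eq, OfNat.ofNat_ne_zero, not_false_eq_true, zero_pow, sub_self, sub_zero]
    have : 0 ≤ V + η * x + η ^ 2 * K - (V + η * p) ^ a * (V + η * q) ^ b := by linarith
    positivity)
  have e1 : V ^ (a - 1) * V ^ b = 1 := by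
    rw [← Real.rpow_add hV, show a - 1 + b = 0 by linarith, Real.rpow_zero]
  have e2 : V ^ a * V ^ (b - 1) = 1 := by
    rw [← Real.rpow_add hV, show a + (b - 1) = 0 by linarith, Real.rpow_zero]
  simp only [zero_mul, add_zero] at h0
  linear_combination h0 - p * a * e1 - q * b * e2

section

variable {n : ℕ} {A B C : Set (EuclideanSpace ℝ (Fin n))} {a b : ℝ}

/-- The Prékopa–Leindler inequality for exponentials of continuous functions on compact sets. -/
theorem setIntegral_exp_rpow_mul_le (ha : 0 < a) (hb : 0 < b) (hab : a + b = 1)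
    (hA : IsCompact A) (hB : IsCompact B) (hC : IsCompact C)
    (hABC : ∀ x ∈ A, ∀ y ∈ B, a • x + b • y ∈ C) {α β γ : EuclideanSpace ℝ (Fin n) → ℝ}
    (hα : Continuous α) (hβ : Continuous β) (hγ : Continuous γ)
    (h : ∀ x ∈ A, ∀ y ∈ B, a * α x + b * β y ≤ γ (a • x + b • y)) :
    (∫ x in A, Real.exp (α x)) ^ a * (∫ x in B, Real.exp (β x)) ^ b
      ≤ ∫ x in C, Real.exp (γ x) := by
  have key : ∀ (S : Set (EuclideanSpace ℝ (Fin n))) (u : EuclideanSpace ℝ (Fin n) → ℝ),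
      IsCompact S → Continuous u →
      ∫⁻ x, S.indicator (fun x => ENNReal.ofReal (Real.exp (u x))) x
        = ENNReal.ofReal (∫ x in S, Real.exp (u x)) := by
    intro S u hS hu
    rw [lintegral_indicator hS.measurableSet, ofReal_integral_eq_lintegral_ofReal]
    · exact (Real.continuous_exp.comp hu).continuousOn.integrableOn_compact hS
    · exact ae_of_all _ fun x => (Real.exp_pos _).le
  have hm : ∀ (S : Set (EuclideanSpace ℝ (Fin n))) (u : EuclideanSpace ℝ (Fin n) → ℝ),
      IsCompact S → Continuous u →
      Measurable (S.indicator (fun x => ENNReal.ofReal (Real.exp (u x)))) := fun S u hS hu =>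
    (Real.continuous_exp.comp hu).measurable.ennreal_ofReal.indicator hS.measurableSet
  have hpos : ∀ (S : Set (EuclideanSpace ℝ (Fin n))) (u : EuclideanSpace ℝ (Fin n) → ℝ),
      0 ≤ ∫ x in S, Real.exp (u x) := fun S u => integral_nonneg fun x => (Real.exp_pos _).le
  have := prekopa_leindler ha hb hab (hm A α hA hα) (hm B β hB hβ) (hm C γ hC hγ) (by
    intro x y
    by_cases hx : x ∈ A
    · by_cases hy : y ∈ B
      · rw [indicator_of_mem hx, indicator_of_mem hy, indicator_of_mem (hABC x hx y hy),
          ENNReal.ofReal_rpow_of_nonneg (Real.exp_pos _).le ha.le,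
          ENNReal.ofReal_rpow_of_nonneg (Real.exp_pos _).le hb.le,
          ← ENNReal.ofReal_mul (by positivity), ← Real.exp_mul, ← Real.exp_mul, ← Real.exp_add]
        gcongr
        linarith [h x hx y hy]
      · simp [indicator_of_notMem hy, ENNReal.zero_rpow_of_pos hb]
    · simp [indicator_of_notMem hx, ENNReal.zero_rpow_of_pos ha])
  rw [key A α hA hα, key B β hB hβ, key C γ hC hγ, ENNReal.ofReal_rpow_of_nonneg (hpos _ _) ha.le,
    ENNReal.ofReal_rpow_of_nonneg (hpos _ _) hb.le,
    ← ENNReal.ofReal_mul (Real.rpow_nonneg (hpos _ _) _)] at this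
  exact (ENNReal.ofReal_le_ofReal_iff (hpos _ _)).1 this

/-- The multiplicative Brunn–Minkowski inequality for compact sets. -/
theorem volume_real_rpow_mul_le (ha : 0 < a) (hb : 0 < b) (hab : a + b = 1)
    (hA : IsCompact A) (hB : IsCompact B) (hC : IsCompact C)
    (hABC : ∀ x ∈ A, ∀ y ∈ B, a • x + b • y ∈ C) :
    volume.real A ^ a * volume.real B ^ b ≤ volume.real C := by
  simpa using setIntegral_exp_rpow_mul_le ha hb hab hA hB hC hABC (α := fun _ => 0)
    (β := fun _ => 0) (γ := fun _ => 0) continuous_const continuous_const continuous_const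
    (by simp)

/-- Since `exp t ≤ 1 + t + t²` for `|t| ≤ 1`, the right side is at most `V + η ∫ γ + O(η²)`, and
first-order terms can be compared. `P` and `Q` are left free so that both exponential and `cosh`
integrals fit. -/
theorem add_setIntegral_le_of_rpow_mul_le {V : ℝ} (ha : 0 < a) (hb : 0 < b) (hab : a + b = 1)
    (hC : IsCompact C) (hV : 0 < V) (hCV : volume.real C = V)
    {γ : EuclideanSpace ℝ (Fin n) → ℝ} (hγ : Continuous γ) {p q : ℝ}
    (h : ∀ᶠ η in 𝓝[>] (0 : ℝ), ∃ P Q, V + η * p ≤ P ∧ V + η * q ≤ Q ∧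
      P ^ a * Q ^ b ≤ ∫ x in C, Real.exp (η * γ x)) :
    a * p + b * q ≤ ∫ x in C, γ x := by
  obtain ⟨M, hM⟩ := hC.exists_bound_of_continuousOn hγ.continuousOn
  have hsmall : ∀ c : ℝ, ∀ᶠ η in 𝓝[>] (0 : ℝ), 0 ≤ V + η * c := fun c => by
    have : Tendsto (fun η : ℝ => V + η * c) (𝓝[>] 0) (𝓝 (V + 0 * c)) :=
      ((by fun_prop : Continuous fun η : ℝ => V + η * c).tendsto 0).mono_left nhdsWithin_le_nhds
    exact (this.eventually_const_lt (by simpa using hV)).mono fun _ => le_of_lt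
  have hMs : ∀ᶠ η in 𝓝[>] (0 : ℝ), η * M ≤ 1 := by
    have : Tendsto (fun η : ℝ => η * M) (𝓝[>] 0) (𝓝 (0 * M)) :=
      ((by fun_prop : Continuous fun η : ℝ => η * M).tendsto 0).mono_left nhdsWithin_le_nhds
    exact (this.eventually_lt_const (by simp)).mono fun _ => le_of_lt
  refine Real.add_le_of_rpow_mul_rpow_le (K := ∫ x in C, γ x ^ 2) hab hV ?_
  filter_upwards [h, hsmall p, hsmall q, hMs, self_mem_nhdsWithin] with η hη hp hq hM1 hpos
  have hpos : 0 < η := hpos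
  obtain ⟨P, Q, hP, hQ, hPQ⟩ := hη
  have hint : ∀ {u : EuclideanSpace ℝ (Fin n) → ℝ}, Continuous u → IntegrableOn u C :=
    fun hu => hu.continuousOn.integrableOn_compact hC
  calc (V + η * p) ^ a * (V + η * q) ^ b ≤ P ^ a * Q ^ b :=
        mul_le_mul (Real.rpow_le_rpow hp hP ha.le) (Real.rpow_le_rpow hq hQ hb.le)
          (Real.rpow_nonneg hq _) (Real.rpow_nonneg (hp.trans hP) _)
    _ ≤ ∫ x in C, Real.exp (η * γ x) := hPQ
    _ ≤ ∫ x in C, (1 + η * γ x + η ^ 2 * γ x ^ 2) := by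
      refine setIntegral_mono_on (hint (by fun_prop)) (hint (by fun_prop)) hC.measurableSet
        fun x hx => ?_
      have h1 : |η * γ x| ≤ 1 := by
        rw [abs_mul, abs_of_pos hpos]
        exact (mul_le_mul_of_nonneg_left (hM x hx) hpos.le).trans hM1
      have := (abs_le.1 (Real.abs_exp_sub_one_sub_id_le h1)).2
      linarith [mul_pow η (γ x) 2]
    _ = _ := by
      rw [integral_add (hint (by fun_prop)) (hint (by fun_prop)),
        integral_add (hint (by fun_prop)) (hint (by fun_prop)), integral_const_mul,
        integral_const_mul]
      simp [hCV]

/-- First-order version of the Prékopa–Leindler inequality, for sets with equality in the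
Brunn–Minkowski inequality. -/
theorem add_setIntegral_le_setIntegral {V : ℝ} (ha : 0 < a) (hb : 0 < b) (hab : a + b = 1)
    (hA : IsCompact A) (hB : IsCompact B) (hC : IsCompact C)
    (hABC : ∀ x ∈ A, ∀ y ∈ B, a • x + b • y ∈ C) (hV : 0 < V) (hAV : volume.real A = V)
    (hBV : volume.real B = V) (hCV : volume.real C = V) {α β γ : EuclideanSpace ℝ (Fin n) → ℝ}
    (hα : Continuous α) (hβ : Continuous β) (hγ : Continuous γ)
    (h : ∀ x ∈ A, ∀ y ∈ B, a * α x + b * β y ≤ γ (a • x + b • y)) :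
    a * (∫ x in A, α x) + b * (∫ x in B, β x) ≤ ∫ x in C, γ x := by
  refine add_setIntegral_le_of_rpow_mul_le ha hb hab hC hV hCV hγ ?_
  filter_upwards [self_mem_nhdsWithin] with η hpos
  have hpos : 0 < η := hpos
  have key : ∀ (S : Set (EuclideanSpace ℝ (Fin n))) (u : EuclideanSpace ℝ (Fin n) → ℝ),
      IsCompact S → volume.real S = V → Continuous u →
      V + η * (∫ x in S, u x) ≤ ∫ x in S, Real.exp (η * u x) := by
    intro S u hS hSV hu
    have hint : ∀ {u : EuclideanSpace ℝ (Fin n) → ℝ}, Continuous u → IntegrableOn u S :=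
      fun hu => hu.continuousOn.integrableOn_compact hS
    calc _ = ∫ x in S, (1 + η * u x) := by
          rw [integral_add (hint (by fun_prop)) (hint (by fun_prop)), integral_const_mul]
          simp [hSV]
      _ ≤ _ := setIntegral_mono_on (hint (by fun_prop)) (hint (by fun_prop)) hS.measurableSet
          fun x hx => by linarith [Real.add_one_le_exp (η * u x)]
  refine ⟨_, _, key A α hA hAV hα, key B β hB hBV hβ, ?_⟩
  refine setIntegral_exp_rpow_mul_le ha hb hab hA hB hC hABC (hα.const_mul _) (hβ.const_mul _)
    (hγ.const_mul _) fun x hx y hy => ?_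
  linarith [mul_le_mul_of_nonneg_left (h x hx y hy) hpos.le]

/-- Averaging over `x` and `-x` removes the term of first order in `ε`. -/
theorem setIntegral_exp_eq_cosh (hA : IsCompact A) (hAs : ∀ x ∈ A, -x ∈ A)
    (u : EuclideanSpace ℝ (Fin n) →L[ℝ] ℝ) (ε : ℝ) :
    ∫ x in A, Real.exp (ε * u x) = ∫ x in A, Real.cosh (ε * u x) := by
  have hneg : Neg.neg ⁻¹' A = A := by
    ext x; exact ⟨fun h => by simpa using hAs _ h, hAs x⟩
  have h1 := (Measure.measurePreserving_neg (volume : Measure (EuclideanSpace ℝ (Fin n)))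
    ).setIntegral_preimage_emb (MeasurableEquiv.neg _).measurableEmbedding
    (fun x => Real.exp (ε * u x)) A
  rw [hneg] at h1
  have hint : ∀ {u : EuclideanSpace ℝ (Fin n) → ℝ}, Continuous u → IntegrableOn u A :=
    fun hu => hu.continuousOn.integrableOn_compact hA
  simp only [Real.cosh_eq]
  rw [integral_div, integral_add (hint (by fun_prop)) (hint (by fun_prop))]
  simp only [map_neg, mul_neg] at h1
  rw [h1]; ring

/-- Second moments are concave along symmetric sets with equality in the Brunn–Minkowski
inequality. -/
theorem add_setIntegral_sq_le {V : ℝ} (ha : 0 < a) (hb : 0 < b) (hab : a + b = 1)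
    (hA : IsCompact A) (hB : IsCompact B) (hC : IsCompact C)
    (hAs : ∀ x ∈ A, -x ∈ A) (hBs : ∀ x ∈ B, -x ∈ B) (hCs : ∀ x ∈ C, -x ∈ C)
    (hABC : ∀ x ∈ A, ∀ y ∈ B, a • x + b • y ∈ C) (hV : 0 < V) (hAV : volume.real A = V)
    (hBV : volume.real B = V) (hCV : volume.real C = V)
    (u : EuclideanSpace ℝ (Fin n) →L[ℝ] ℝ) :
    a * (∫ x in A, u x ^ 2) + b * (∫ x in B, u x ^ 2) ≤ ∫ x in C, u x ^ 2 := by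
  have key : ∀ S : Set (EuclideanSpace ℝ (Fin n)), IsCompact S → volume.real S = V → ∀ ε : ℝ,
      V + ε ^ 2 * (∫ x in S, u x ^ 2 / 2) ≤ ∫ x in S, Real.cosh (ε * u x) := by
    intro S hS hSV ε
    have hint : ∀ {u : EuclideanSpace ℝ (Fin n) → ℝ}, Continuous u → IntegrableOn u S :=
      fun hu => hu.continuousOn.integrableOn_compact hS
    calc _ = ∫ x in S, (1 + ε ^ 2 * (u x ^ 2 / 2)) := by
          rw [integral_add (hint (by fun_prop)) (hint (by fun_prop)), integral_const_mul]
          simp [hSV]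
      _ ≤ _ := setIntegral_mono_on (hint (by fun_prop)) (hint (by fun_prop)) hS.measurableSet
          fun x hx => by linarith [Real.one_add_sq_div_two_le_cosh (ε * u x), mul_pow ε (u x) 2]
  have := add_setIntegral_le_of_rpow_mul_le ha hb hab hC hV hCV (γ := fun x => u x ^ 2 / 2)
    (p := ∫ x in A, u x ^ 2 / 2) (q := ∫ x in B, u x ^ 2 / 2) (by fun_prop) (by
      filter_upwards [self_mem_nhdsWithin] with η hpos
      have hpos : 0 < η := hpos
      -- Scaling `u` by `√η` makes its second-order term first order in `η`. On `C`, `cosh t ≤ exp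
      -- (t²/2)` brings the integrand to the form `exp (η γ)`.
      have hsq : √η ^ 2 = η := Real.sq_sqrt hpos.le
      refine ⟨_, _, hsq ▸ key A hA hAV √η, hsq ▸ key B hB hBV √η, ?_⟩
      have h1 := setIntegral_exp_rpow_mul_le ha hb hab hA hB hC hABC (α := fun x => √η * u x)
        (β := fun x => √η * u x) (γ := fun x => √η * u x) (by fun_prop) (by fun_prop)
        (by fun_prop) (fun x _ y _ => by simp only [map_add, map_smul, smul_eq_mul]; linarith)
      rw [setIntegral_exp_eq_cosh hA hAs, setIntegral_exp_eq_cosh hB hBs,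
        setIntegral_exp_eq_cosh hC hCs] at h1
      refine h1.trans (setIntegral_mono_on ?_ ?_ hC.measurableSet fun x hx => ?_)
      · exact Continuous.continuousOn (by fun_prop) |>.integrableOn_compact hC
      · exact Continuous.continuousOn (by fun_prop) |>.integrableOn_compact hC
      · refine (Real.cosh_le_exp_half_sq _).trans_eq ?_
        rw [mul_pow, hsq, mul_div_assoc])
  simp only [integral_div] at this
  linarith

/-- From `‖ax + by‖² = a‖x‖² + b‖y‖² - ab‖x - y‖²`, the gain `ab‖x - y‖²` absorbs `ε (g x - g y) ≤ ε
‖x - y‖` up to `ε²/(4ab)`. The first-order inequality is then met by concavity of second moments,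
leaving an error of order `ε²` against `ε (∫_A g - ∫_B g)`. -/
theorem setIntegral_le_of_lipschitzWith {V : ℝ} (ha : 0 < a) (hb : 0 < b) (hab : a + b = 1)
    (hA : IsCompact A) (hB : IsCompact B) (hC : IsCompact C)
    (hAs : ∀ x ∈ A, -x ∈ A) (hBs : ∀ x ∈ B, -x ∈ B) (hCs : ∀ x ∈ C, -x ∈ C)
    (hABC : ∀ x ∈ A, ∀ y ∈ B, a • x + b • y ∈ C) (hV : 0 < V) (hAV : volume.real A = V)
    (hBV : volume.real B = V) (hCV : volume.real C = V)
    {g : EuclideanSpace ℝ (Fin n) → ℝ} (hg : LipschitzWith 1 g) :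
    ∫ x in A, g x ≤ ∫ x in B, g x := by
  have hgc := hg.continuous
  have hint : ∀ {S : Set (EuclideanSpace ℝ (Fin n))}, IsCompact S →
      ∀ {u : EuclideanSpace ℝ (Fin n) → ℝ}, Continuous u → IntegrableOn u S :=
    fun hS _ hu => hu.continuousOn.integrableOn_compact hS
  have hsum : ∀ S : Set (EuclideanSpace ℝ (Fin n)), IsCompact S →
      ∫ x in S, ‖x‖ ^ 2 = ∑ i, ∫ x in S, (EuclideanSpace.proj i : _ →L[ℝ] ℝ) x ^ 2 := by
    intro S hS
    rw [← integral_finsetSum _ fun i _ => hint hS (by fun_prop)]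
    simp [EuclideanSpace.real_norm_sq_eq]
  have hmom : a * (∫ x in A, ‖x‖ ^ 2) + b * (∫ x in B, ‖x‖ ^ 2) ≤ ∫ x in C, ‖x‖ ^ 2 := by
    rw [hsum A hA, hsum B hB, hsum C hC, Finset.mul_sum, Finset.mul_sum, ← Finset.sum_add_distrib]
    exact Finset.sum_le_sum fun i _ => add_setIntegral_sq_le ha hb hab hA hB hC hAs hBs hCs hABC hV
      hAV hBV hCV _
  have hε : ∀ ε : ℝ, 0 < ε →
      (∫ x in A, g x) - (∫ x in B, g x) ≤ ε * (V / (4 * a * b)) := by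
    intro ε hε
    have h1 := add_setIntegral_le_setIntegral ha hb hab hA hB hC hABC hV hAV hBV hCV
      (α := fun x => -‖x‖ ^ 2 + ε / a * g x) (β := fun x => -‖x‖ ^ 2 - ε / b * g x)
      (γ := fun x => -‖x‖ ^ 2 + ε ^ 2 / (4 * a * b)) (by fun_prop) (by fun_prop) (by fun_prop) (by
        intro x hx y hy
        have hD : g x - g y ≤ ‖x - y‖ := by
          have := hg.dist_le_mul x y
          rw [Real.dist_eq, dist_eq_norm] at this
          simpa using (le_abs_self _).trans this
        have hpar : ‖a • x + b • y‖ ^ 2 = a * ‖x‖ ^ 2 + b * ‖y‖ ^ 2 - a * b * ‖x - y‖ ^ 2 := by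
          rw [norm_add_sq_real, norm_sub_sq_real, norm_smul, norm_smul, inner_smul_left,
            inner_smul_right, Real.norm_of_nonneg ha.le, Real.norm_of_nonneg hb.le]
          simp only [conj_trivial]
          obtain rfl : b = 1 - a := by linarith
          ring
        have hsq : ε * ‖x - y‖ ≤ a * b * ‖x - y‖ ^ 2 + ε ^ 2 / (4 * a * b) := by
          have : a * b * ‖x - y‖ ^ 2 + ε ^ 2 / (4 * a * b) - ε * ‖x - y‖
              = (2 * a * b * ‖x - y‖ - ε) ^ 2 / (4 * a * b) := by field_simp; ring
          have : 0 ≤ (2 * a * b * ‖x - y‖ - ε) ^ 2 / (4 * a * b) := by positivity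
          linarith
        have e1 : a * (ε / a * g x) = ε * g x := by field_simp
        have e2 : b * (ε / b * g y) = ε * g y := by field_simp
        rw [hpar]
        linarith [mul_le_mul_of_nonneg_left hD hε.le])
    rw [integral_add (hint hA (by fun_prop)) (hint hA (by fun_prop)),
      integral_sub (hint hB (by fun_prop)) (hint hB (by fun_prop)),
      integral_add (hint hC (by fun_prop)) (hint hC (by fun_prop)), integral_const_mul,
      integral_const_mul, integral_neg, integral_neg, integral_neg, setIntegral_const, hCV,
      smul_eq_mul] at h1
    have e1 : a * (ε / a * ∫ x in A, g x) = ε * ∫ x in A, g x := by field_simp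
    have e2 : b * (ε / b * ∫ x in B, g x) = ε * ∫ x in B, g x := by field_simp
    have h2 : ε * ((∫ x in A, g x) - ∫ x in B, g x) ≤ ε * (ε * (V / (4 * a * b))) := by
      have e3 : V * (ε ^ 2 / (4 * a * b)) = ε * (ε * (V / (4 * a * b))) := by ring
      linarith
    exact le_of_mul_le_mul_left h2 hε
  have ht : Tendsto (fun ε : ℝ => ε * (V / (4 * a * b))) (𝓝[>] 0) (𝓝 (0 * (V / (4 * a * b)))) :=
    ((by fun_prop : Continuous fun ε : ℝ => ε * (V / (4 * a * b))).tendsto 0).mono_left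
      nhdsWithin_le_nhds
  have := ge_of_tendsto ht (eventually_mem_nhdsWithin.mono hε)
  linarith

/-! ### Equality in Brunn–Minkowski for symmetric convex bodies -/

theorem Convex.interior_nonempty_of_volume_real_pos (hA : Convex ℝ A) (hV : 0 < volume.real A) :
    (interior A).Nonempty := by
  by_contra h
  rw [not_nonempty_iff_eq_empty] at h
  have : volume A = 0 := measure_mono_null
    (by rw [frontier, h, sdiff_empty]; exact subset_closure) (hA.addHaar_frontier volume)
  simp [measureReal_def, this] at hV

/-- `interior A \ B` is open and null, hence empty, and a convex set with interior lies in the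
closure of its interior. -/
theorem Convex.subset_of_volume_sdiff_eq_zero (hA : Convex ℝ A) (hV : 0 < volume.real A)
    (hB : IsClosed B) (h : volume (A \ B) = 0) : A ⊆ B := by
  have h1 : interior A ⊆ B := by
    have h0 : interior A \ B = ∅ := by
      refine IsOpen.eq_empty_of_measure_zero (isOpen_interior.sdiff hB)
        (measure_mono_null (sdiff_subset_sdiff_left interior_subset) h)
    exact sdiff_eq_empty.1 h0
  calc A ⊆ closure A := subset_closure
    _ = closure (interior A) := (hA.closure_interior_eq_closure_of_nonempty_interior
        (hA.interior_nonempty_of_volume_real_pos hV)).symm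
    _ ⊆ B := closure_minimal h1 hB

theorem Convex.eq_of_subset_of_volume_real_le (hB : Convex ℝ B) (hA : IsCompact A)
    (hBc : IsCompact B) (hV : 0 < volume.real B) (hAB : A ⊆ B)
    (h : volume.real B ≤ volume.real A) : A = B := by
  refine hAB.antisymm (hB.subset_of_volume_sdiff_eq_zero hV hA.isClosed ?_)
  have h1 := measureReal_sdiff (μ := volume) hAB hA.measurableSet hBc.measure_lt_top.ne
  have h2 : volume (B \ A) ≠ ⊤ :=
    ne_top_of_le_ne_top hBc.measure_lt_top.ne (measure_mono sdiff_subset)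
  refine (measureReal_eq_zero_iff h2).1 (le_antisymm (by linarith) measureReal_nonneg)

/-- The equality case of the Brunn–Minkowski inequality for symmetric convex bodies. -/
theorem eq_of_volume_real_eq {V : ℝ} (ha : 0 < a) (hb : 0 < b) (hab : a + b = 1)
    (hA : IsCompact A) (hB : IsCompact B) (hC : IsCompact C)
    (hAs : ∀ x ∈ A, -x ∈ A) (hBs : ∀ x ∈ B, -x ∈ B) (hCs : ∀ x ∈ C, -x ∈ C)
    (hAc : Convex ℝ A) (hBc : Convex ℝ B) (hCc : Convex ℝ C)
    (hABC : ∀ x ∈ A, ∀ y ∈ B, a • x + b • y ∈ C) (hV : 0 < V) (hAV : volume.real A = V)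
    (hBV : volume.real B = V) (hCV : volume.real C = V) : A = B ∧ A = C := by
  have hB0 : B.Nonempty := by
    rw [nonempty_iff_ne_empty]; rintro rfl; simp at hBV; exact hV.ne hBV
  have hgc : Continuous fun x => Metric.infDist x B := Metric.continuous_infDist_pt B
  have hi := setIntegral_le_of_lipschitzWith ha hb hab hA hB hC hAs hBs hCs hABC hV hAV hBV hCV
    (Metric.lipschitz_infDist_pt B)
  have h0 : ∫ x in B, Metric.infDist x B = 0 :=
    (setIntegral_congr_fun hB.measurableSet fun x hx => Metric.infDist_zero_of_mem hx).trans
      (by simp)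
  have h1 : ∫ x in A, Metric.infDist x B = 0 :=
    le_antisymm (hi.trans h0.le) (integral_nonneg fun x => Metric.infDist_nonneg)
  rw [setIntegral_eq_zero_iff_of_nonneg_ae (ae_of_all _ fun x => Metric.infDist_nonneg)
    (hgc.continuousOn.integrableOn_compact hA), EventuallyEq, ae_restrict_iff' hA.measurableSet]
    at h1
  have hAB : A ⊆ B := by
    refine hAc.subset_of_volume_sdiff_eq_zero (hAV ▸ hV) hB.isClosed ?_
    refine measure_mono_null (fun x hx => ?_) (ae_iff.1 h1)
    exact fun h => hx.2 ((hB.isClosed.mem_iff_infDist_zero hB0).2 (h hx.1))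
  have hAB' := hBc.eq_of_subset_of_volume_real_le hA hB (hBV ▸ hV) hAB (by rw [hAV, hBV])
  subst hAB'
  refine ⟨rfl, hCc.eq_of_subset_of_volume_real_le hA hC (hCV ▸ hV) (fun x hx => ?_)
    (by rw [hAV, hCV])⟩
  simpa [← add_smul, hab] using hABC x hx x hx

/-! ### Intersections of two translates of K -/

variable {K : Set (EuclideanSpace ℝ (Fin n))}

/-- The intersection `(K - s) ∩ (K + s)` of two translates of `K`, which is symmetric for
symmetric `K`. -/
def centeredIntersection (K : Set (EuclideanSpace ℝ (Fin n))) (s : EuclideanSpace ℝ (Fin n)) :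
    Set (EuclideanSpace ℝ (Fin n)) :=
  {z | z + s ∈ K ∧ z - s ∈ K}

theorem mem_centeredIntersection {s z : EuclideanSpace ℝ (Fin n)} :
    z ∈ centeredIntersection K s ↔ z + s ∈ K ∧ z - s ∈ K := Iff.rfl

theorem IsCompact.centeredIntersection (hK : IsCompact K) (s : EuclideanSpace ℝ (Fin n)) :
    IsCompact (centeredIntersection K s) := by
  refine (hK.image (continuous_sub_right s)).of_isClosed_subset
    ((hK.isClosed.preimage (continuous_add_const s)).inter
      (hK.isClosed.preimage (continuous_sub_right s))) fun z hz => ⟨z + s, hz.1, by simp⟩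

theorem Convex.centeredIntersection (hK : Convex ℝ K) (s : EuclideanSpace ℝ (Fin n)) :
    Convex ℝ (centeredIntersection K s) := by
  intro x hx y hy a b ha hb hab
  refine ⟨?_, ?_⟩
  · convert! hK hx.1 hy.1 ha hb hab using 1
    rw [smul_add, smul_add, add_add_add_comm, ← add_smul, hab, one_smul]
  · convert! hK hx.2 hy.2 ha hb hab using 1
    rw [smul_sub, smul_sub, sub_add_sub_comm, ← add_smul, hab, one_smul]

theorem neg_mem_centeredIntersection (hs : ∀ x ∈ K, -x ∈ K) {s z : EuclideanSpace ℝ (Fin n)}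
    (hz : z ∈ centeredIntersection K s) : -z ∈ centeredIntersection K s :=
  ⟨by simpa [add_comm, sub_eq_add_neg] using hs _ hz.2,
    by simpa [add_comm, sub_eq_add_neg] using hs _ hz.1⟩

theorem Convex.combo_mem_centeredIntersection (hK : Convex ℝ K) (ha : 0 < a) (hb : 0 < b)
    (hab : a + b = 1) {p q x y : EuclideanSpace ℝ (Fin n)} (hx : x ∈ _root_.centeredIntersection K p)
    (hy : y ∈ _root_.centeredIntersection K q) :
    a • x + b • y ∈ _root_.centeredIntersection K (a • p + b • q) := by
  refine ⟨?_, ?_⟩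
  · convert! hK hx.1 hy.1 ha.le hb.le hab using 1
    rw [smul_add, smul_add, add_add_add_comm]
  · convert! hK hx.2 hy.2 ha.le hb.le hab using 1
    rw [smul_sub, smul_sub, sub_add_sub_comm]

theorem volume_real_inter_vadd (K : Set (EuclideanSpace ℝ (Fin n)))
    (x : EuclideanSpace ℝ (Fin n)) :
    volume.real (K ∩ (x +ᵥ K)) = volume.real (centeredIntersection K ((2⁻¹ : ℝ) • x)) := by
  have hx : (2⁻¹ : ℝ) • x + (2⁻¹ : ℝ) • x = x := by rw [← add_smul]; norm_num
  have : K ∩ (x +ᵥ K) = ((2⁻¹ : ℝ) • x) +ᵥ centeredIntersection K ((2⁻¹ : ℝ) • x) := by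
    ext z
    rw [mem_inter_iff, mem_vadd_set_iff_neg_vadd_mem, mem_vadd_set_iff_neg_vadd_mem,
      mem_centeredIntersection, vadd_eq_add, vadd_eq_add]
    have e1 : -((2⁻¹ : ℝ) • x) + z + (2⁻¹ : ℝ) • x = z := by abel
    have e2 : -((2⁻¹ : ℝ) • x) + z - (2⁻¹ : ℝ) • x = -x + z := by
      nth_rewrite 3 [← hx]; abel
    rw [e1, e2]
  rw [this, measureReal_def, measure_vadd, measureReal_def]

/-- The volume is continuous at `w` by dominated convergence: indicators converge at `z` unless `z -
w` is on the frontier of `K`, which is null by convexity. -/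
theorem isOpen_lt_volume_real_inter_vadd (hK : IsCompact K) (hKc : Convex ℝ K) (δ : ℝ) :
    IsOpen {x : EuclideanSpace ℝ (Fin n) | δ < volume.real (K ∩ (x +ᵥ K))} := by
  refine isOpen_lt continuous_const (continuous_iff_continuousAt.2 fun w => ?_)
  refine (ENNReal.tendsto_toReal (measure_ne_top_of_subset inter_subset_left
    hK.measure_lt_top.ne)).comp ?_
  refine tendsto_measure_of_ae_tendsto_indicator _
    (hK.measurableSet.inter (hK.vadd w).measurableSet)
    (fun v => hK.measurableSet.inter (hK.vadd v).measurableSet) hK.measurableSet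
    hK.measure_lt_top.ne (Eventually.of_forall fun v => inter_subset_left) ?_
  have hnull : volume {z | z + -w ∈ frontier K} = 0 := by
    have := measure_preimage_add_right volume (-w) (frontier K)
    rw [hKc.addHaar_frontier volume] at this
    exact this
  filter_upwards [compl_mem_ae_iff.2 hnull] with z hz
  have ht : Tendsto (fun v => -v + z) (𝓝 w) (𝓝 (-w + z)) :=
    (by fun_prop : Continuous fun v => -v + z).tendsto w
  simp only [mem_inter_iff, mem_vadd_set_iff_neg_vadd_mem, vadd_eq_add]
  by_cases h : -w + z ∈ K
  · have hint : -w + z ∈ interior K := by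
      by_contra hni
      refine hz ?_
      rw [mem_ofPred_eq, add_comm]
      exact ⟨subset_closure h, hni⟩
    filter_upwards [ht.eventually (isOpen_interior.mem_nhds hint)] with v hv
    simp [h, interior_subset hv]
  · filter_upwards [ht.eventually (hK.isClosed.isOpen_compl.mem_nhds h)] with v hv
    have hv : -v + z ∉ K := hv
    simp [h, hv]

/-- At the last point `z` of the common set `A` in direction `d = q - p`, both `z + m` and `z - m`
can still be moved along `d` to reach the points `z + q` and `z - p` of `K`. Both are therefore
interior to `K`, so `z` is interior to `A`, contradicting its being last. -/
theorem eq_of_centeredIntersection_eq (hK : IsCompact K) (hKc : Convex ℝ K) (ha : 0 < a)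
    (hb : 0 < b) (hab : a + b = 1) {p q : EuclideanSpace ℝ (Fin n)}
    (hpq : centeredIntersection K p = centeredIntersection K q)
    (hpm : centeredIntersection K p = centeredIntersection K (a • p + b • q))
    (hint : (interior (centeredIntersection K p)).Nonempty) : p = q := by
  by_contra hne
  set d := q - p with hd
  have hd0 : d ≠ 0 := sub_ne_zero.2 (Ne.symm hne)
  set m := a • p + b • q with hm
  set A := centeredIntersection K p with hA
  obtain ⟨w, hw⟩ := hint
  have hAc : IsCompact A := hK.centeredIntersection p
  -- the last point of `A` on the ray from `w` in direction `d`
  have hline : IsClosedEmbedding fun c : ℝ => w + c • d :=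
    (Homeomorph.addLeft w).isClosedEmbedding.comp (isClosedEmbedding_smul_left hd0)
  obtain ⟨c, hcA, hcmax⟩ := (hline.isCompact_preimage hAc).exists_isGreatest
    ⟨0, by simpa using interior_subset hw⟩
  have hev : ∀ z ∈ interior A, ∀ᶠ t in 𝓝[>] (0 : ℝ), z + t • d ∈ A := by
    intro z hz
    have ht : Tendsto (fun t : ℝ => z + t • d) (𝓝[>] 0) (𝓝 z) := by
      simpa using ((by fun_prop : Continuous fun t : ℝ => z + t • d).tendsto 0).mono_left
        (nhdsWithin_le_nhds (s := Ioi 0))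
    exact ht.eventually (mem_interior_iff_mem_nhds.1 hz)
  set z := w + c • d with hz
  have hzint : z ∉ interior A := by
    intro h
    obtain ⟨t, htA, ht⟩ := ((hev z h).and self_mem_nhdsWithin).exists
    have ht : 0 < t := ht
    have : c + t ≤ c := hcmax (by
      simpa only [mem_preimage, add_smul, ← add_assoc] using htA)
    linarith
  have hc0 : 0 < c := by
    refine lt_of_le_of_ne (hcmax (by simpa using interior_subset hw)) fun h => hzint ?_
    simpa [hz, ← h] using hw
  have htrans : ∀ v, (∀ x ∈ A, x + v ∈ K) → w + v ∈ interior K := fun v hv => by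
    have : (fun x => x + -v) ⁻¹' interior A ⊆ interior K :=
      interior_maximal (fun x hx => by simpa using hv _ (interior_subset hx))
        (isOpen_interior.preimage (continuous_add_const _))
    exact this (by simpa using hw)
  -- `z + v` lies strictly between the interior point `w + v`, at distance `c` behind in units of
  -- `d`, and a point of `K` at distance `e` ahead; hence the weights.
  have hseg : ∀ e : ℝ, 0 < e → ∀ v, (∀ x ∈ A, x + v ∈ K) → z + v + e • d ∈ K →
      z + v ∈ interior K := by
    intro e he v hv hK'
    have := hKc.combo_interior_self_mem_interior (htrans v hv) hK' (a := e / (e + c))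
      (b := c / (e + c)) (by positivity) (by positivity) (by field_simp)
    convert! this using 1
    have h1 : w + v = z + v - c • d := by rw [hz]; abel
    rw [h1]
    match_scalars <;> field_simp <;> ring
  refine hzint ?_
  have hzp : z ∈ centeredIntersection K p := hcA
  have hzq : z ∈ centeredIntersection K q := hpq ▸ hzp
  -- Here `m + a • d = q`; below, `-m + b • d = -p`.
  have hplus : z + m ∈ interior K := by
    refine hseg a ha m (fun x hx => ?_) ?_
    · have : x ∈ centeredIntersection K m := hpm ▸ hx
      exact this.1
    · convert! hzq.1 using 1
      rw [hm, hd]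
      obtain rfl : b = 1 - a := by linarith
      module
  have hminus : z + -m ∈ interior K := by
    refine hseg b hb (-m) (fun x hx => ?_) ?_
    · have : x ∈ centeredIntersection K m := hpm ▸ hx
      simpa [sub_eq_add_neg] using this.2
    · convert! hzp.2 using 1
      rw [hm, hd]
      obtain rfl : b = 1 - a := by linarith
      module
  rw [hpm]
  refine interior_maximal (s := centeredIntersection K m)
    (t := (fun x => x + m) ⁻¹' interior K ∩ (fun x => x + -m) ⁻¹' interior K)
    (fun x hx => ⟨interior_subset hx.1, ?_⟩)
    ((isOpen_interior.preimage (continuous_add_const _)).inter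
      (isOpen_interior.preimage (continuous_add_const _))) ⟨hplus, hminus⟩
  rw [sub_eq_add_neg]
  exact interior_subset hx.2

theorem lt_volume_real_centeredIntersection (hK : IsCompact K) (hKc : Convex ℝ K)
    (hs : ∀ x ∈ K, -x ∈ K) (ha : 0 < a) (hb : 0 < b) (hab : a + b = 1)
    {p q : EuclideanSpace ℝ (Fin n)} (hpq : p ≠ q) {δ : ℝ} (hδ : 0 < δ)
    (hp : δ ≤ volume.real (centeredIntersection K p))
    (hq : δ ≤ volume.real (centeredIntersection K q)) :
    δ < volume.real (centeredIntersection K (a • p + b • q)) := by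
  by_contra! hle
  have hbm := volume_real_rpow_mul_le ha hb hab (hK.centeredIntersection p)
    (hK.centeredIntersection q) (hK.centeredIntersection (a • p + b • q))
    (fun x hx y hy => hKc.combo_mem_centeredIntersection ha hb hab hx hy)
  set P := volume.real (centeredIntersection K p) with hP
  set Q := volume.real (centeredIntersection K q) with hQ
  have hδδ : δ ^ a * δ ^ b = δ := by rw [← Real.rpow_add hδ, hab, Real.rpow_one]
  have hδa : 0 < δ ^ a := by positivity
  have hδb : 0 < δ ^ b := by positivity
  have hPa : δ ^ a ≤ P ^ a := Real.rpow_le_rpow hδ.le hp ha.le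
  have hQb : δ ^ b ≤ Q ^ b := Real.rpow_le_rpow hδ.le hq hb.le
  -- An excess of `P` or `Q` over `δ` would make `P^a Q^b > δ`, against Brunn–Minkowski and `hle`.
  have hPe : P = δ := by
    refine le_antisymm (not_lt.1 fun h => ?_) hp
    have := Real.rpow_lt_rpow hδ.le h ha
    nlinarith [mul_le_mul_of_nonneg_left hQb (hδa.le.trans hPa)]
  have hQe : Q = δ := by
    refine le_antisymm (not_lt.1 fun h => ?_) hq
    have := Real.rpow_lt_rpow hδ.le h hb
    nlinarith [mul_le_mul_of_nonneg_right hPa (hδb.le.trans hQb)]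
  rw [hPe, hQe, hδδ] at hbm
  obtain ⟨h1, h2⟩ := eq_of_volume_real_eq ha hb hab (hK.centeredIntersection p)
    (hK.centeredIntersection q) (hK.centeredIntersection (a • p + b • q))
    (fun _ => neg_mem_centeredIntersection hs) (fun _ => neg_mem_centeredIntersection hs)
    (fun _ => neg_mem_centeredIntersection hs) (hKc.centeredIntersection p)
    (hKc.centeredIntersection q) (hKc.centeredIntersection _)
    (fun x hx y hy => hKc.combo_mem_centeredIntersection ha hb hab hx hy) hδ hPe hQe
    (le_antisymm hle hbm)
  exact hpq (eq_of_centeredIntersection_eq hK hKc ha hb hab h1 h2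
    ((hKc.centeredIntersection p).interior_nonempty_of_volume_real_pos (hP ▸ hPe ▸ hδ)))

end

/-! ### Strict convexity of the convolution body -/

theorem proposition2p2 {n : ℕ} (K : ConvexBody (EuclideanSpace ℝ (Fin n)))
    (hint : (interior (K : Set (EuclideanSpace ℝ (Fin n)))).Nonempty)
    (hsymm : ∀ x ∈ K, -x ∈ K)
    (δ : ℝ) (hδ : 0 < δ)
    (hδK : δ < MeasureTheory.volume.real (K : Set (EuclideanSpace ℝ (Fin n)))) :
    StrictConvex ℝ (convolutionBody (K : Set (EuclideanSpace ℝ (Fin n))) δ) := by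
  intro x hx y hy hxy a b ha hb hab
  have hx : δ ≤ volume.real ((K : Set (EuclideanSpace ℝ (Fin n))) ∩ (x +ᵥ (K : Set (EuclideanSpace ℝ (Fin n))))) := hx
  have hy : δ ≤ volume.real ((K : Set (EuclideanSpace ℝ (Fin n))) ∩ (y +ᵥ (K : Set (EuclideanSpace ℝ (Fin n))))) := hy
  have hsub : {w : EuclideanSpace ℝ (Fin n) |
      δ < volume.real ((K : Set (EuclideanSpace ℝ (Fin n))) ∩ (w +ᵥ (K : Set (EuclideanSpace ℝ (Fin n)))))} ⊆
      convolutionBody (K : Set (EuclideanSpace ℝ (Fin n))) δ := by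
    intro w hw
    simp only [convolutionBody, mem_ofPred_eq] at hw ⊢
    exact hw.le
  refine interior_maximal hsub (isOpen_lt_volume_real_inter_vadd K.isCompact K.convex δ) ?_
  rw [volume_real_inter_vadd] at hx hy
  rw [mem_ofPred_eq, volume_real_inter_vadd, smul_add, smul_comm _ a, smul_comm _ b]
  refine lt_volume_real_centeredIntersection K.isCompact K.convex hsymm ha hb hab ?_ hδ hx hy
  exact fun h => hxy (smul_right_injective _ (by norm_num : (2⁻¹ : ℝ) ≠ 0) h)
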